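/- Let $T\ge0$ and let $\Omega=D^+[0,T]$ be the set of all càdlàg functions $\omega:[0,T]\to[0,\infty)$. For $t\in[0,T]$ let $\mathcal F^\circ_t$ be the smallest $\sigma$-algebra on $\Omega$ making $\omega\mapsto\omega(s)$ measurable for all $s\in[0,t]$, and let $\mathcal F_t$ be the universal completion of $\mathcal F^\circ_t$ (the intersection of its completions with respect to all probability measures on $\mathcal F^\circ_t$). Stopping times take values in $[0,T]\cup\{\infty\}$ and, like the $\sigma$-algebras $\mathcal F_\tau$, are taken with respect to $(\mathcal F_t)$. A simple trading strategy $G$ consists of an initial capital $c\in\mathbb R$, stopping times $\tau_1\le\tau_2\le\cdots$ such that for each $\omega\in\Omega$ only finitely many $\tau_n(\omega)$ are finite, and, for each $n\ge1$, a bounded $\mathcal F_{\tau_n}$-measurable function $h_n:\Omega\to\mathbb R$. Its simple capital process is $$\mathcal K^G_t(\omega)=c+\sum_{n=1}^\infty h_n(\omega)\bigl(\omega(\tau_{n+1}(\omega)\wedge t)-\omega(\tau_n(\omega)\wedge t)\bigr),\qquad t\in[0,T].$$ A positive capital process is a family $S_t:\Omega\to[0,\infty]$, $t\in[0,T]$,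 with each $S_t$ being $\mathcal F_t$-measurable, of the form $S_t(\omega)=\sum_{m=1}^\infty\mathcal K^{G_m}_t(\omega)$, where $G_1,G_2,\dots$ are simple trading strategies such that $\mathcal K^{G_m}_t(\omega)\ge0$ for all $m$, $t$ and $\omega$, and the series $\sum_m c_m$ of their initial capitals converges. A property of $\omega\in\Omega$ holds for typical $\omega$ if there is a positive capital process $S$ with $S_0=1$ such that $S_T(\omega)=\infty$ for every $\omega\in\Omega$ for which the property fails. For $p>0$ and $f:[0,T]\to\mathbb R$ let $\mathrm{var}_p(f)=\sup\sum_{i=1}^n|f(t_i)-f(t_{i-1})|^p$, the supremum being over all $n\ge1$ and all partitions $0=t_0\le t_1\le\cdots\le t_n=T$. The variation index is $\mathrm{vi}(f)=\inf\{p>0:\mathrm{var}_p(f)<\infty\}\in[0,\infty]$ (with $\inf\emptyset=\infty$); for bounded $f$ it is the unique $v\in[0,\infty]$ such that $\mathrm{var}_p(f)$ is finite for $p>v$ and infinite for $p<v$. **Theorem.** For typical $\omega\in D^+[0,T]$, $\mathrm{vi}(\omega)\le2$. -/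

import Mathlib

open MeasureTheory Filter Topology
open scoped ENNReal

namespace TypicalPaths

/-- The trading period `[0, T]`. -/
abbrev Period (T : ℝ) : Type := Set.Icc (0 : ℝ) T

/-- The initial time `0` of the trading period. -/
def startTime {T : ℝ} (hT : 0 ≤ T) : Period T := ⟨0, le_refl 0, hT⟩

/-- The final time `T` of the trading period. -/
def endTime {T : ℝ} (hT : 0 ≤ T) : Period T := ⟨T, hT, le_refl T⟩

/-- The sample space `D⁺[0, T]`: positive (in the wide sense) functions on `[0, T]` that are
right-continuous and have finite left limits. (At time `0` the filter `𝓝[<] t` is trivial, so the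
left-limit condition is void there; similarly for right-continuity at time `T`.) -/
structure PricePath (T : ℝ) where
  toFun : Period T → ℝ
  nonneg' : ∀ t, 0 ≤ toFun t
  rightContinuous' : ∀ t, ContinuousWithinAt toFun (Set.Ici t) t
  leftLimit' : ∀ t, ∃ l : ℝ, Tendsto toFun (𝓝[<] t) (𝓝 l)

instance (T : ℝ) : CoeFun (PricePath T) (fun _ => Period T → ℝ) := ⟨PricePath.toFun⟩

/-! ### The filtration -/

/-- The universal completion of a σ-algebra: the intersection of its completions with respect to
all probability measures on it. -/
@[reducible]
def universalCompletion {α : Type*} (m : MeasurableSpace α) : MeasurableSpace α :=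
  ⨅ (μ : @Measure α m) (_ : @IsProbabilityMeasure α m μ),
    @eventuallyMeasurableSpace α m (@ae α (@Measure α m) _ _ μ) _

theorem measurableSet_universalCompletion_iff {α : Type*} (m : MeasurableSpace α) (s : Set α) :
    MeasurableSet[universalCompletion m] s ↔
      ∀ μ : Measure α, IsProbabilityMeasure μ → NullMeasurableSet s μ := by
  simp only [MeasurableSpace.measurableSet_iInf]
  rfl

theorem universalCompletion_mono {α : Type*} {m₁ m₂ : MeasurableSpace α} (h : m₁ ≤ m₂) :
    universalCompletion m₁ ≤ universalCompletion m₂ := by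
  intro s hs
  rw [measurableSet_universalCompletion_iff] at hs ⊢
  intro μ hμ
  obtain ⟨t, ht, hst⟩ := hs (μ.trim h) ⟨by rw [trim_measurableSet_eq h MeasurableSet.univ, measure_univ]⟩
  exact ⟨t, h t ht, ae_eq_of_ae_eq_trim hst⟩

/-- `ℱ°_t`: the smallest σ-algebra making all `ω ↦ ω s`, `s ≤ t`, measurable. -/
@[reducible]
def rawSigmaAlgebra {T : ℝ} (t : Period T) : MeasurableSpace (PricePath T) :=
  ⨆ (s : Period T) (_ : s ≤ t), MeasurableSpace.comap (fun ω : PricePath T => ω s) inferInstance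

theorem rawSigmaAlgebra_mono {T : ℝ} : Monotone (rawSigmaAlgebra (T := T)) :=
  fun _ _ h => biSup_mono fun _ hs => hs.trans h

/-- The filtration `(ℱ_t)`, where `ℱ_t` is the universal completion of `ℱ°_t`.
The ambient σ-algebra is the universal completion of the σ-algebra generated by all
coordinates, which for `0 ≤ T` is `ℱ_T`. -/
def priceFiltration (T : ℝ) :
    Filtration (Period T) (universalCompletion (⨆ t : Period T, rawSigmaAlgebra t)) where
  seq t := universalCompletion (rawSigmaAlgebra t)
  mono' _ _ h := universalCompletion_mono (rawSigmaAlgebra_mono h)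
  le' t := universalCompletion_mono (le_iSup (fun t : Period T => rawSigmaAlgebra t) t)

/-! ### Trading -/

/-- Simple trading strategies (with the sequences indexed from `0` rather than from `1`).
Stopping times take values in `[0, T] ∪ {∞}`, the value `∞` being `⊤`. -/
structure SimpleStrategy (T : ℝ) where
  /-- the initial capital -/
  initial : ℝ
  /-- the stopping times at which positions are taken -/
  time : ℕ → PricePath T → WithTop (Period T)
  isStoppingTime : ∀ n, IsStoppingTime (priceFiltration T) (time n)
  monotone_time : ∀ ω, Monotone fun n => time n ω
  finite_time : ∀ ω, {n | time n ω ≠ ⊤}.Finite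
  /-- the positions taken -/
  position : ℕ → PricePath T → ℝ
  measurable_position : ∀ n, Measurable[(isStoppingTime n).measurableSpace] (position n)
  bounded_position : ∀ n, ∃ C : ℝ, ∀ ω, |position n ω| ≤ C

/-- `τ ∧ t` as a point of `[0, T]`. -/
def capTime {T : ℝ} (τ : WithTop (Period T)) (t : Period T) : Period T := min (τ.untopD t) t

/-- The simple capital process of a simple trading strategy; for each `ω` all but finitely many
terms of the sum are zero. -/
noncomputable def SimpleStrategy.capital {T : ℝ} (G : SimpleStrategy T) (t : Period T)
    (ω : PricePath T) : ℝ :=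
  G.initial + ∑ᶠ n : ℕ, G.position n ω *
    (ω (capTime (G.time (n + 1) ω) t) - ω (capTime (G.time n ω) t))

theorem SimpleStrategy.finite_support_capital {T : ℝ} (G : SimpleStrategy T) (t : Period T)
    (ω : PricePath T) :
    (Function.support fun n : ℕ => G.position n ω *
      (ω (capTime (G.time (n + 1) ω) t) - ω (capTime (G.time n ω) t))).Finite := by
  refine (G.finite_time ω).subset fun n hn htop => hn ?_
  have h1 : G.time (n + 1) ω = ⊤ := top_le_iff.mp (htop ▸ G.monotone_time ω (Nat.le_succ n))
  simp [htop, h1]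

/-- Positive capital processes: adapted processes that are sums of a sequence of positive simple
capital processes whose initial capitals have a convergent sum. The value `∞` is allowed. -/
def IsPositiveCapitalProcess {T : ℝ} (S : Period T → PricePath T → ℝ≥0∞) : Prop :=
  (∀ t, Measurable[priceFiltration T t] (S t)) ∧
  ∃ G : ℕ → SimpleStrategy T,
    (∀ m t ω, 0 ≤ (G m).capital t ω) ∧
    (Summable fun m => (G m).initial) ∧
    ∀ t ω, S t ω = ∑' m, ENNReal.ofReal ((G m).capital t ω)

/-- A set of price paths is null if some positive capital process starting from `1` is infinite at
time `T` on all of it. -/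
def IsNull {T : ℝ} (hT : 0 ≤ T) (E : Set (PricePath T)) : Prop :=
  ∃ S : Period T → PricePath T → ℝ≥0∞, IsPositiveCapitalProcess S ∧
    (∀ ω, S (startTime hT) ω = 1) ∧ ∀ ω ∈ E, S (endTime hT) ω = ∞

/-- A property holds for typical price paths if the set of paths where it fails is null. -/
def ForTypical {T : ℝ} (hT : 0 ≤ T) (P : PricePath T → Prop) : Prop :=
  IsNull hT {ω | ¬ P ω}

/-! ### Variation -/

/-- The `p`-variation of `f : [0, T] → ℝ`: the supremum over all partitions
`0 = t₀ ≤ t₁ ≤ ⋯ ≤ tₙ = T`, `n ≥ 1`, of the sum of `|f (tᵢ₊₁) - f (tᵢ)| ^ p`. -/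
noncomputable def pVariation {T : ℝ} (p : ℝ) (f : Period T → ℝ) : ℝ≥0∞ :=
  ⨆ (n : ℕ) (u : Fin (n + 1) → Period T)
    (_ : 1 ≤ n ∧ Monotone u ∧ (u 0 : ℝ) = 0 ∧ (u (Fin.last n) : ℝ) = T),
    ∑ i : Fin n, ENNReal.ofReal (|f (u i.succ) - f (u i.castSucc)| ^ p)

/-- The variation index of `f`, an element of `[0, ∞]`: the infimum of the exponents `p > 0` with
finite `p`-variation. -/
noncomputable def variationIndex {T : ℝ} (f : Period T → ℝ) : ℝ≥0∞ :=
  ⨅ (p : ℝ) (_ : 0 < p ∧ pVariation p f < ∞), ENNReal.ofReal p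

/-- For a bounded function, `p`-variation is finite for all exponents above a finite one. -/
theorem pVariation_lt_top_of_le {T : ℝ} {f : Period T → ℝ} {C : ℝ} (hC : ∀ t, |f t| ≤ C)
    {p q : ℝ} (hp : 0 < p) (hpq : p ≤ q) (h : pVariation p f < ∞) : pVariation q f < ∞ := by
  have key : pVariation q f ≤ ENNReal.ofReal ((2 * C) ^ (q - p)) * pVariation p f := by
    refine iSup_le fun n => iSup_le fun u => iSup_le fun hu => ?_
    calc ∑ i : Fin n, ENNReal.ofReal (|f (u i.succ) - f (u i.castSucc)| ^ q)
        ≤ ∑ i : Fin n, ENNReal.ofReal ((2 * C) ^ (q - p)) *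
            ENNReal.ofReal (|f (u i.succ) - f (u i.castSucc)| ^ p) := by
          refine Finset.sum_le_sum fun i _ => ?_
          rw [← ENNReal.ofReal_mul' (by positivity)]
          refine ENNReal.ofReal_le_ofReal ?_
          have hx : |f (u i.succ) - f (u i.castSucc)| ≤ 2 * C := by
            have := abs_sub (f (u i.succ)) (f (u i.castSucc))
            linarith [hC (u i.succ), hC (u i.castSucc)]
          rcases (abs_nonneg (f (u i.succ) - f (u i.castSucc))).eq_or_lt with h0 | h0
          · rw [← h0, Real.zero_rpow (hp.trans_le hpq).ne', Real.zero_rpow hp.ne', mul_zero]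
          · rw [← sub_add_cancel q p, Real.rpow_add h0, sub_add_cancel]
            gcongr
      _ = ENNReal.ofReal ((2 * C) ^ (q - p)) *
            ∑ i : Fin n, ENNReal.ofReal (|f (u i.succ) - f (u i.castSucc)| ^ p) :=
          (Finset.mul_sum _ _ _).symm
      _ ≤ _ := by
          gcongr
          exact le_iSup_of_le n (le_iSup_of_le u (le_iSup_of_le hu le_rfl))
  exact key.trans_lt (ENNReal.mul_lt_top ENNReal.ofReal_lt_top h)

/-- For a bounded function `f`, the variation index is the unique number `v ∈ [0, ∞]` such that
the `p`-variation of `f` is finite when `p > v` and infinite when `p < v`. -/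
theorem variationIndex_eq_iff {T : ℝ} {f : Period T → ℝ} {C : ℝ} (hC : ∀ t, |f t| ≤ C)
    (v : ℝ≥0∞) :
    variationIndex f = v ↔ ∀ p : ℝ, 0 < p →
      (v < ENNReal.ofReal p → pVariation p f < ∞) ∧
      (ENNReal.ofReal p < v → pVariation p f = ∞) := by
  have spec : ∀ p : ℝ, 0 < p →
      (variationIndex f < ENNReal.ofReal p → pVariation p f < ∞) ∧
      (ENNReal.ofReal p < variationIndex f → pVariation p f = ∞) := by
    refine fun p hp => ⟨fun h => ?_, fun h => ?_⟩
    · simp only [variationIndex, iInf_lt_iff] at h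
      obtain ⟨q, ⟨hq, hfin⟩, hqp⟩ := h
      exact pVariation_lt_top_of_le hC hq ((ENNReal.ofReal_lt_ofReal_iff hp).mp hqp).le hfin
    · by_contra hne
      exact absurd h (not_lt.mpr (iInf₂_le p ⟨hp, lt_top_iff_ne_top.mpr hne⟩))
  have uniq : ∀ v w : ℝ≥0∞, v < w →
      (∀ p : ℝ, 0 < p → v < ENNReal.ofReal p → pVariation p f < ∞) →
      (∀ p : ℝ, 0 < p → ENNReal.ofReal p < w → pVariation p f = ∞) → False := by
    intro v w hvw h1 h2
    obtain ⟨r, hvr, hrw⟩ := ENNReal.lt_iff_exists_nnreal_btwn.mp hvw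
    have hr : 0 < (r : ℝ) := by exact_mod_cast (zero_le).trans_lt hvr
    have e : ENNReal.ofReal (r : ℝ) = r := ENNReal.ofReal_coe_nnreal
    exact (h1 r hr (e ▸ hvr)).ne (h2 r hr (e ▸ hrw))
  constructor
  · rintro rfl
    exact spec
  · intro h
    rcases lt_trichotomy (variationIndex f) v with hlt | heq | hgt
    · exact (uniq _ _ hlt (fun p hp => (spec p hp).1) (fun p hp => (h p hp).2)).elim
    · exact heq
    · exact (uniq _ _ hgt (fun p hp => (h p hp).1) (fun p hp => (spec p hp).2)).elim

end TypicalPaths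

namespace TypicalPaths

variable {T : ℝ}

/-! ### Local behaviour of price paths -/

/-! A trader can profit from oscillations of size `δ`, so a path on which the profit stays finite
has few of them.

Let x_0, x_1, … be the prices at the successive times at which the path has moved by `δ` from its
price at the preceding such time. The function φ(x) = ((L - x)⁺)² is convex with derivative -2(L -
x)⁺, so holding 2(L - x_n)⁺ shares after the n-th time gains at least the drop in φ
(`sq_max_sub_sq_max_le`). Prices are nonnegative, hence 0 ≤ φ ≤ L² and an initial capital L² keeps
the capital nonnegative on every path (`moveStrategy_capital_nonneg`). On paths bounded by L, φ is
exactly quadratic, and the second-order remainder makes the capital at least ∑ (x_{n+1} - x_n)²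
(`sum_sq_le_moveStrategy_capital`).

A move need not end far from its start: the path may approach distance `δ` from the left and then
jump back. Such a jump has size at least `δ / 2` and is caught as a good move at scale `δ / 4`
(`isGoodMove_or_isGoodMove`). Hence good moves at the two scales together control all increments of
size at least `2δ` (`exists_isGoodMove_mem_Ioc`).

Finally, mix the strategies with `δ` = 4^(-j) and L = j + 1, with initial capitals summing to 1. If
the total capital at time `T` is finite, the number of increments of size at least 2·4^(-j) in any
partition is at most 16^j times a polynomial in j, for all large j. Summing over scales gives finite
p-variation for every p > 2 (`pVariation_lt_top_of_card_le`). -/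

theorem PricePath.exists_right_close (ω : PricePath T) (t : Period T) {ε : ℝ} (hε : 0 < ε) :
    ∃ d > 0, ∀ r, t ≤ r → dist r t < d → |ω r - ω t| < ε := by
  obtain ⟨d, hd, h⟩ := Metric.continuousWithinAt_iff.mp (ω.rightContinuous' t) ε hε
  exact ⟨d, hd, fun r hr hrd => h hr hrd⟩

/-- Left limits, in terms of intervals. -/
theorem PricePath.exists_left_limit (ω : PricePath T) (t : Period T) :
    ∃ l : ℝ, ∀ ε > 0, ∀ s < t, ∃ a < t, s ≤ a ∧ ∀ r, a < r → r < t → |ω r - l| < ε := by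
  obtain ⟨l, hl⟩ := ω.leftLimit' t
  refine ⟨l, fun ε hε s hs => ?_⟩
  have h1 : {r | |ω r - l| < ε} ∈ 𝓝[<] t := hl (Metric.ball_mem_nhds l hε)
  obtain ⟨a, ha, hsub⟩ := (mem_nhdsLT_iff_exists_Ioo_subset' hs).mp h1
  exact ⟨max s a, max_lt hs ha, le_max_left _ _, fun r hr hrt =>
    hsub ⟨(le_max_right _ _).trans_lt hr, hrt⟩⟩

/-- Price paths are bounded. -/
theorem PricePath.exists_bound (ω : PricePath T) : ∃ C : ℝ, ∀ t, ω t ≤ C := by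
  have key : ∃ C : ℝ, ∀ t ∈ (Set.univ : Set (Period T)), ω t ≤ C := by
    refine isCompact_univ.induction_on (p := fun s => ∃ C : ℝ, ∀ t ∈ s, ω t ≤ C) ⟨0, by simp⟩
      (fun s t hst ⟨C, hC⟩ => ⟨C, fun r hr => hC r (hst hr)⟩)
      (fun s t ⟨C, hC⟩ ⟨D, hD⟩ => ⟨max C D, ?_⟩) (fun t _ => ?_)
    · rintro r (hr | hr)
      · exact (hC r hr).trans (le_max_left _ _)
      · exact (hD r hr).trans (le_max_right _ _)
    · obtain ⟨l, hl⟩ := ω.leftLimit' t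
      have h1 : ∀ᶠ r in 𝓝[<] t, ω r ≤ max (l + 1) (ω t + 1) :=
        (hl.eventually_le_const (lt_add_one l)).mono fun r hr => hr.trans (le_max_left _ _)
      have h2 : ∀ᶠ r in 𝓝[≥] t, ω r ≤ max (l + 1) (ω t + 1) :=
        ((ω.rightContinuous' t).eventually_le_const (lt_add_one (ω t))).mono
          fun r hr => hr.trans (le_max_right _ _)
      have h3 : ∀ᶠ r in 𝓝 t, ω r ≤ max (l + 1) (ω t + 1) := by
        rw [← nhdsLT_sup_nhdsGE]
        exact eventually_sup.mpr ⟨h1, h2⟩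
      exact ⟨_, mem_nhdsWithin_of_mem_nhds h3, _, fun r hr => hr⟩
  exact key.imp fun C hC t => hC t (Set.mem_univ t)

/-! ### The successive times at which the path has moved by a given amount -/

/-- The largest distance from `ω s` over the interval `[s, t]` is at least `δ`. -/
def Moves (δ : ℝ) (ω : PricePath T) (s t : Period T) : Prop :=
  s ≤ t ∧ ∀ η > 0, ∃ r, s ≤ r ∧ r ≤ t ∧ δ - η < |ω r - ω s|

theorem Moves.mono {δ : ℝ} {ω : PricePath T} {s t t' : Period T} (h : Moves δ ω s t)
    (htt : t ≤ t') : Moves δ ω s t' :=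
  ⟨h.1.trans htt, fun η hη => (h.2 η hη).imp fun _ hr => ⟨hr.1, hr.2.1.trans htt, hr.2.2⟩⟩

theorem Moves.lt {δ : ℝ} (hδ : 0 < δ) {ω : PricePath T} {s t : Period T} (h : Moves δ ω s t) :
    s < t := by
  refine lt_of_le_of_ne h.1 ?_
  rintro rfl
  obtain ⟨r, h1, h2, h3⟩ := h.2 δ hδ
  obtain rfl := le_antisymm h1 h2
  simp at h3

theorem moves_of_le {δ : ℝ} {ω : PricePath T} {s t : Period T} (hst : s ≤ t)
    (h : δ ≤ |ω t - ω s|) : Moves δ ω s t :=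
  ⟨hst, fun η hη => ⟨t, hst, le_rfl, by linarith⟩⟩

theorem exists_le_sub_of_not_moves {δ : ℝ} {ω : PricePath T} {s t : Period T} (hst : s ≤ t)
    (h : ¬ Moves δ ω s t) : ∃ η > 0, ∀ r, s ≤ r → r ≤ t → |ω r - ω s| ≤ δ - η := by
  simp only [Moves, not_and, not_forall, not_exists, not_lt] at h
  obtain ⟨η, hη, h⟩ := h hst
  exact ⟨η, hη, fun r h1 h2 => h r h1 h2⟩

/-- If the supremum over `[s, t]` is below `δ`, right-continuity at `t` keeps it below `δ` slightly
beyond `t`, and earlier times are covered by monotonicity. Hence there is a first move time even if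
distance `δ` is only approached as a left limit. -/
theorem isClosed_setOf_moves (δ : ℝ) (ω : PricePath T) (s : Period T) :
    IsClosed {t | Moves δ ω s t} := by
  refine isOpen_compl_iff.mp (isOpen_iff_mem_nhds.mpr fun t ht => ?_)
  rcases lt_or_ge t s with hts | hst
  · exact mem_of_superset (Iio_mem_nhds hts) fun r (hr : r < s) h => absurd h.1 (not_le.mpr hr)
  · obtain ⟨η, hη, hb⟩ := exists_le_sub_of_not_moves hst ht
    obtain ⟨d, hd, hd'⟩ := ω.exists_right_close t (half_pos hη)
    refine mem_of_superset (Metric.ball_mem_nhds t hd) fun r hr hm => ?_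
    obtain ⟨q, hq1, hq2, hq3⟩ := hm.2 (η / 2) (half_pos hη)
    rcases le_total q t with hqt | hqt
    · linarith [hb q hq1 hqt]
    · have hqd : dist q t < d := by
        refine lt_of_le_of_lt ?_ (Metric.mem_ball.mp hr)
        rw [Subtype.dist_eq, Subtype.dist_eq, Real.dist_eq, Real.dist_eq,
          abs_of_nonneg (sub_nonneg.mpr (Subtype.coe_le_coe.mpr hqt)),
          abs_of_nonneg (sub_nonneg.mpr (Subtype.coe_le_coe.mpr (hqt.trans hq2)))]
        exact sub_le_sub_right (Subtype.coe_le_coe.mpr hq2) _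
      have h1 := hd' q hqt hqd
      have h2 := hb t hst le_rfl
      have h3 := abs_sub_le (ω q) (ω t) (ω s)
      linarith

theorem exists_isLeast_moves {δ : ℝ} {ω : PricePath T} {s : Period T}
    (h : ∃ t, Moves δ ω s t) : ∃ t, IsLeast {t | Moves δ ω s t} t :=
  (isClosed_setOf_moves δ ω s).isCompact.exists_isLeast h

open Classical in
/-- The first time at which `ω` has moved by `δ` away from `ω s`. -/
noncomputable def nextMove (δ : ℝ) (ω : PricePath T) (s : Period T) : WithTop (Period T) :=
  if h : ∃ t, Moves δ ω s t then (Classical.choose (exists_isLeast_moves h) : Period T) else ⊤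

/-- The set of `t` with `Moves δ ω s t` is upward closed and, if nonempty, has a least element. In
this form the event depends only on the path up to `t`, as a stopping time requires. -/
theorem nextMove_le_iff {δ : ℝ} {ω : PricePath T} {s t : Period T} :
    nextMove δ ω s ≤ t ↔ Moves δ ω s t := by
  unfold nextMove
  split_ifs with h
  · have hl := Classical.choose_spec (exists_isLeast_moves h)
    rw [WithTop.coe_le_coe]
    exact ⟨fun hle => Moves.mono hl.1 hle, fun hm => hl.2 hm⟩
  · simp only [top_le_iff, WithTop.coe_ne_top, false_iff]
    exact fun hm => h ⟨t, hm⟩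

/-- The successive times at which `ω` has moved by `δ`. -/
noncomputable def moveTime (hT : 0 ≤ T) (δ : ℝ) : ℕ → PricePath T → WithTop (Period T)
  | 0, _ => (startTime hT : Period T)
  | n + 1, ω => (moveTime hT δ n ω).recTopCoe ⊤ (nextMove δ ω)

theorem startTime_le (hT : 0 ≤ T) (t : Period T) : startTime hT ≤ t := t.2.1

theorem le_endTime (hT : 0 ≤ T) (t : Period T) : t ≤ endTime hT := t.2.2

section

variable {hT : 0 ≤ T} {δ : ℝ} {ω : PricePath T}

theorem moveTime_succ_of_eq_top {n : ℕ} (h : moveTime hT δ n ω = ⊤) :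
    moveTime hT δ (n + 1) ω = ⊤ := by
  simp [moveTime, h]

theorem moveTime_succ_of_eq_coe {n : ℕ} {s : Period T} (h : moveTime hT δ n ω = s) :
    moveTime hT δ (n + 1) ω = nextMove δ ω s := by
  simp [moveTime, h]

theorem moveTime_succ_le_iff {n : ℕ} {t : Period T} :
    moveTime hT δ (n + 1) ω ≤ t ↔ ∃ s : Period T, moveTime hT δ n ω = s ∧ Moves δ ω s t := by
  cases h : moveTime hT δ n ω with
  | top => simp [moveTime_succ_of_eq_top h]
  | coe s =>
    rw [moveTime_succ_of_eq_coe h, nextMove_le_iff]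
    simp

theorem monotone_moveTime (hT : 0 ≤ T) (δ : ℝ) (ω : PricePath T) :
    Monotone fun n => moveTime hT δ n ω := by
  refine monotone_nat_of_le_succ fun n => ?_
  cases h : moveTime hT δ (n + 1) ω with
  | top => exact le_top
  | coe t =>
    obtain ⟨s, hs, hm⟩ := moveTime_succ_le_iff.mp h.le
    rw [hs]
    exact WithTop.coe_le_coe.mpr hm.1

theorem moveTime_eq_top_of_le {m n : ℕ} (hmn : m ≤ n) (hm : moveTime hT δ m ω = ⊤) :
    moveTime hT δ n ω = ⊤ :=
  top_le_iff.mp (hm.ge.trans (monotone_moveTime hT δ ω hmn))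

theorem moves_of_moveTime_eq {n : ℕ} {s t : Period T} (hs : moveTime hT δ n ω = s)
    (ht : moveTime hT δ (n + 1) ω = t) : Moves δ ω s t := by
  rw [moveTime_succ_of_eq_coe hs] at ht
  exact nextMove_le_iff.mp ht.le

/-- Only finitely many moves take place, since `ω` has left limits. -/
theorem exists_moveTime_eq_top (hT : 0 ≤ T) (hδ : 0 < δ) (ω : PricePath T) :
    ∃ n, moveTime hT δ n ω = ⊤ := by
  by_contra! h
  choose s hs using fun n => WithTop.ne_top_iff_exists.mp (h n)
  have hmv : ∀ n, Moves δ ω (s n) (s (n + 1)) := fun n => moves_of_moveTime_eq (hs n).symm (hs _).symm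
  have hmono : StrictMono s := strictMono_nat_of_lt_succ fun n => (hmv n).lt hδ
  obtain ⟨u, hu⟩ : ∃ u, IsLUB (Set.range s) u := by
    have : Nonempty (Period T) := ⟨s 0⟩
    obtain ⟨u, -, hu⟩ := (isClosed_closure (s := Set.range s)).isCompact.exists_isLUB
      (Set.range_nonempty s).closure
    exact ⟨u, (isLUB_congr (upperBounds_closure _)).mp hu⟩
  have hlt : ∀ n, s n < u := fun n => (hmono (Nat.lt_succ_self n)).trans_le (hu.1 ⟨n + 1, rfl⟩)
  obtain ⟨l, hl⟩ := ω.exists_left_limit u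
  -- Close to the accumulation point `u`, any two earlier values differ by less than `δ / 2`,
  -- whereas each move contains a displacement exceeding `δ / 2`.
  obtain ⟨a, ha, -, hclose⟩ := hl (δ / 4) (by linarith) (s 0) (hlt 0)
  obtain ⟨_, ⟨n, rfl⟩, hn⟩ := (lt_isLUB_iff hu).mp ha
  obtain ⟨r, hr1, hr2, hr3⟩ := (hmv n).2 (δ / 2) (by linarith)
  have h1 := hclose (s n) hn (hlt n)
  have h2 := hclose r (hn.trans_le hr1) (hr2.trans_lt (hlt _))
  have h3 := abs_sub_le (ω r) l (ω (s n))
  rw [abs_sub_comm l] at h3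
  linarith

theorem finite_moveTime_ne_top (hT : 0 ≤ T) (hδ : 0 < δ) (ω : PricePath T) :
    {n | moveTime hT δ n ω ≠ ⊤}.Finite := by
  obtain ⟨N, hN⟩ := exists_moveTime_eq_top hT hδ ω
  refine (Set.finite_lt_nat N).subset fun n hn => ?_
  by_contra hle
  exact hn (moveTime_eq_top_of_le (not_lt.mp hle) hN)

/-- For a down-closed condition that holds at time `0` but not at `∞`, there is a last time at
which it holds. -/
theorem exists_last_moveTime (hδ : 0 < δ) (P : WithTop (Period T) → Prop)
    (h0 : P (startTime hT : Period T)) (htop : ¬ P ⊤) :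
    ∃ (n : ℕ) (s : Period T), moveTime hT δ n ω = s ∧ P s ∧ ¬ P (moveTime hT δ (n + 1) ω) := by
  obtain ⟨N, hN⟩ := exists_moveTime_eq_top hT hδ ω
  have : ∃ n, P (moveTime hT δ n ω) ∧ ¬ P (moveTime hT δ (n + 1) ω) := by
    by_contra! h
    have : ∀ n, P (moveTime hT δ n ω) := fun n => by
      induction n with
      | zero => exact h0
      | succ n ih => exact h n ih
    exact htop (hN ▸ this N)
  obtain ⟨n, h1, h2⟩ := this
  cases h : moveTime hT δ n ω with
  | top => exact absurd (h ▸ h1) htop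
  | coe s => exact ⟨n, s, h, h ▸ h1, h2⟩

/-! ### Increments and moves -/

/-- A time at which `ω` completes a move by `δ`, ending at distance at least `δ / 2` from where the
move began. -/
def IsGoodMove (hT : 0 ≤ T) (δ : ℝ) (ω : PricePath T) (t : Period T) : Prop :=
  ∃ (n : ℕ) (s : Period T), moveTime hT δ n ω = s ∧ moveTime hT δ (n + 1) ω = t ∧
    δ / 2 ≤ |ω t - ω s|

theorem not_moves_of_lt_moveTime_succ {n : ℕ} {s t : Period T} (hs : moveTime hT δ n ω = s)
    (ht : (t : WithTop (Period T)) < moveTime hT δ (n + 1) ω) : ¬ Moves δ ω s t := by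
  rw [moveTime_succ_of_eq_coe hs] at ht
  exact fun hm => absurd (nextMove_le_iff.mpr hm) (not_le.mpr ht)

/-- Every increment of size at least `2δ` contains the end of a move. -/
theorem exists_moveTime_mem_Ioc (hT : 0 ≤ T) (hδ : 0 < δ) {s t : Period T} (hst : s ≤ t)
    (h : 2 * δ ≤ |ω t - ω s|) :
    ∃ (n : ℕ) (q r : Period T), moveTime hT δ n ω = q ∧ moveTime hT δ (n + 1) ω = r ∧
      s < r ∧ r ≤ t := by
  obtain ⟨n, q, hq, hqs, hns⟩ := exists_last_moveTime (hT := hT) (ω := ω) hδ (fun x => x ≤ s)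
    (WithTop.coe_le_coe.mpr (startTime_le hT s)) (by simp)
  have hqs : q ≤ s := WithTop.coe_le_coe.mp hqs
  have hm : moveTime hT δ (n + 1) ω ≤ t := by
    by_contra hlt
    obtain ⟨η, hη, hb⟩ := exists_le_sub_of_not_moves (hqs.trans hst)
      (not_moves_of_lt_moveTime_succ hq (not_le.mp hlt))
    have h1 := hb t (hqs.trans hst) le_rfl
    have h2 := hb s hqs hst
    have h3 := abs_sub_le (ω t) (ω q) (ω s)
    rw [abs_sub_comm (ω q)] at h3
    linarith
  cases hr : moveTime hT δ (n + 1) ω with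
  | top => simp [hr] at hm
  | coe r =>
    rw [hr] at hm hns
    exact ⟨n, q, r, hq, hr, WithTop.coe_lt_coe.mp (not_le.mp hns), WithTop.coe_le_coe.mp hm⟩

/-- Every jump of size at least `2δ` happens at a good move. -/
theorem isGoodMove_of_jump (hT : 0 ≤ T) (hδ : 0 < δ) {s₀ s : Period T} (hs₀ : s₀ < s) {l : ℝ}
    (hl : ∀ ε > 0, ∀ q < s, ∃ a < s, q ≤ a ∧ ∀ r, a < r → r < s → |ω r - l| < ε)
    (h : 2 * δ ≤ |ω s - l|) : IsGoodMove hT δ ω s := by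
  obtain ⟨n, q, hq, hqs, hns⟩ := exists_last_moveTime (hT := hT) (ω := ω) hδ (fun x => x < s)
    (WithTop.coe_lt_coe.mpr ((startTime_le hT s₀).trans_lt hs₀)) (by simp)
  have hqs : q < s := WithTop.coe_lt_coe.mp hqs
  have hlq : |l - ω q| ≤ δ := by
    refine le_of_forall_pos_lt_add fun ε hε => ?_
    obtain ⟨a, ha, hqa, hclose⟩ := hl ε hε q hqs
    obtain ⟨r, har, hrs⟩ := exists_between ha
    have hqr := hqa.trans har.le
    obtain ⟨η, hη, hb⟩ := exists_le_sub_of_not_moves hqr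
      (not_moves_of_lt_moveTime_succ hq ((WithTop.coe_lt_coe.mpr hrs).trans_le (not_lt.mp hns)))
    have h1 := hb r hqr le_rfl
    have h2 := hclose r har hrs
    have h3 := abs_sub_le l (ω r) (ω q)
    rw [abs_sub_comm l (ω r)] at h3
    linarith
  have hsq : δ ≤ |ω s - ω q| := by
    have h3 := abs_sub_le (ω s) (ω q) l
    rw [abs_sub_comm (ω q)] at h3
    linarith
  have hle : moveTime hT δ (n + 1) ω ≤ s :=
    moveTime_succ_le_iff.mpr ⟨q, hq, moves_of_le hqs.le hsq⟩
  exact ⟨n, q, hq, le_antisymm hle (not_lt.mp hns), by linarith⟩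

/-- The end of a move by `δ` is a good move, if not for `δ` then for `δ / 4`. -/
theorem isGoodMove_or_isGoodMove (hδ : 0 < δ) {n : ℕ} {q r : Period T}
    (hq : moveTime hT δ n ω = q) (hr : moveTime hT δ (n + 1) ω = r) :
    IsGoodMove hT δ ω r ∨ IsGoodMove hT (δ / 4) ω r := by
  by_cases hgood : δ / 2 ≤ |ω r - ω q|
  · exact Or.inl ⟨n, q, hq, hr, hgood⟩
  refine Or.inr ?_
  have hm := moves_of_moveTime_eq hq hr
  have hqr := hm.lt hδ
  obtain ⟨l, hl⟩ := ω.exists_left_limit r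
  refine isGoodMove_of_jump hT (by linarith) hqr hl ?_
  -- The endpoint `ω r` is within `δ / 2` of `ω q`, and no move is completed before `r`, so distance
  -- `δ` can only be approached through the left limit. The jump back then has size at least `δ / 2
  -- = 2 * (δ / 4)`.
  have hlq : δ ≤ |l - ω q| := by
    by_contra! hlt
    obtain ⟨a, ha, hqa, hclose⟩ := hl ((δ - |l - ω q|) / 2) (by linarith) q hqr
    obtain ⟨t, hat, htr⟩ := exists_between ha
    have hqt := hqa.trans hat.le
    obtain ⟨η, hη, hb⟩ := exists_le_sub_of_not_moves hqt
      (not_moves_of_lt_moveTime_succ hq (hr ▸ WithTop.coe_lt_coe.mpr htr))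
    -- The three bounds rule out, in order, `x ≤ t`, `t < x < r` and `x = r`.
    obtain ⟨x, hqx, hxr, hx⟩ := hm.2 (min η (min ((δ - |l - ω q|) / 2) (δ / 2)))
      (lt_min hη (lt_min (by linarith) (by linarith)))
    have m1 := min_le_left η (min ((δ - |l - ω q|) / 2) (δ / 2))
    have m2 := (min_le_right η (min ((δ - |l - ω q|) / 2) (δ / 2))).trans (min_le_left _ _)
    have m3 := (min_le_right η (min ((δ - |l - ω q|) / 2) (δ / 2))).trans (min_le_right _ _)
    rcases le_or_gt x t with hxt | hxt
    · linarith [hb x hqx hxt]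
    · rcases hxr.lt_or_eq with hxr | rfl
      · have h2 := hclose x (hat.trans hxt) hxr
        have h3 := abs_sub_le (ω x) l (ω q)
        linarith
      · linarith
  have h3 := abs_sub_le l (ω r) (ω q)
  rw [abs_sub_comm l (ω r)] at h3
  linarith

/-- Every increment of size at least `2δ` contains a good move, for `δ` or for `δ / 4`. -/
theorem exists_isGoodMove_mem_Ioc (hT : 0 ≤ T) (hδ : 0 < δ) {s t : Period T} (hst : s ≤ t)
    (h : 2 * δ ≤ |ω t - ω s|) :
    ∃ r, s < r ∧ r ≤ t ∧ (IsGoodMove hT δ ω r ∨ IsGoodMove hT (δ / 4) ω r) := by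
  obtain ⟨n, q, r, hq, hr, hsr, hrt⟩ := exists_moveTime_mem_Ioc hT hδ hst h
  exact ⟨r, hsr, hrt, isGoodMove_or_isGoodMove hδ hq hr⟩

end

/-! ### Measurability -/

theorem le_universalCompletion {α : Type*} (m : MeasurableSpace α) : m ≤ universalCompletion m := by
  intro s hs
  rw [measurableSet_universalCompletion_iff]
  exact fun μ _ => hs.nullMeasurableSet

theorem measurable_eval {s t : Period T} (hst : s ≤ t) :
    Measurable[priceFiltration T t] fun ω : PricePath T => ω s := by
  have h : Measurable[rawSigmaAlgebra t] fun ω : PricePath T => ω s :=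
    Measurable.mono (comap_measurable _) (le_iSup₂_of_le s hst le_rfl) le_rfl
  exact h.mono (le_universalCompletion _) le_rfl

theorem capTime_coe (s t : Period T) : capTime (s : WithTop (Period T)) t = min s t := rfl

theorem capTime_top (t : Period T) : capTime ⊤ t = t := min_self t

theorem capTime_le (τ : WithTop (Period T)) (t : Period T) : capTime τ t ≤ t := min_le_right _ _

theorem capTime_le_iff {τ : WithTop (Period T)} {r t : Period T} (hrt : r < t) :
    capTime τ t ≤ r ↔ τ ≤ r := by
  cases τ with
  | top => simp [capTime_top, hrt]
  | coe s => simp [capTime_coe, hrt]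

theorem capTime_of_le {τ : WithTop (Period T)} {t t' : Period T} (h : τ ≤ t) (htt : t ≤ t') :
    capTime τ t' = capTime τ t := by
  cases τ with
  | top => simp at h
  | coe s =>
    have h := WithTop.coe_le_coe.mp h
    rw [capTime_coe, capTime_coe, min_eq_left h, min_eq_left (h.trans htt)]

theorem measurable_capTime {τ : PricePath T → WithTop (Period T)}
    (hτ : IsStoppingTime (priceFiltration T) τ) (t : Period T) :
    Measurable[priceFiltration T t] fun ω => capTime (τ ω) t := by
  let _ : MeasurableSpace (PricePath T) := priceFiltration T t
  refine measurable_of_Iic fun r => ?_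
  rcases lt_or_ge r t with hrt | htr
  · have : (fun ω => capTime (τ ω) t) ⁻¹' Set.Iic r = {ω | τ ω ≤ r} := by
      ext ω
      exact capTime_le_iff hrt
    rw [this]
    exact (priceFiltration T).mono hrt.le _ (hτ r)
  · have : (fun ω => capTime (τ ω) t) ⁻¹' Set.Iic r = Set.univ := by
      ext ω
      simpa using (capTime_le _ _).trans htr
    rw [this]
    exact MeasurableSet.univ

/-- The point `min t ((n + 1) / (k + 1))` of the period. -/
noncomputable def gridPoint (t : Period T) (k n : ℕ) : Period T :=
  ⟨min t ((n + 1) / (k + 1)), le_min t.2.1 (by positivity), (min_le_left _ _).trans t.2.2⟩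

theorem gridPoint_le (t : Period T) (k n : ℕ) : gridPoint t k n ≤ t :=
  Subtype.coe_le_coe.mp (min_le_left _ _)

/-- The value of a price path at a stopping time capped at `t` is known at time `t`. -/
theorem measurable_eval_capTime {τ : PricePath T → WithTop (Period T)}
    (hτ : IsStoppingTime (priceFiltration T) τ) (t : Period T) :
    Measurable[priceFiltration T t] fun ω => ω (capTime (τ ω) t) := by
  let _ : MeasurableSpace (PricePath T) := priceFiltration T t
  have hcap : Measurable fun ω => ((capTime (τ ω) t : Period T) : ℝ) :=
    measurable_subtype_coe.comp (measurable_capTime hτ t)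
  -- The grid point just after the capped time, itself capped at `t`, takes countably many values
  -- and converges to it from the right.
  let idx (k : ℕ) (ω : PricePath T) : ℕ := ⌊((capTime (τ ω) t : Period T) : ℝ) * (k + 1)⌋₊
  refine measurable_of_tendsto_metrizable (f := fun k ω => ω (gridPoint t k (idx k ω)))
    (fun k => ?_) ?_
  · have h1 : Measurable fun p : ℕ × PricePath T => p.2 (gridPoint t k p.1) :=
      measurable_from_prod_countable_right fun n => measurable_eval (gridPoint_le t k n)
    have h2 : Measurable (idx k) := Nat.measurable_floor.comp (hcap.mul_const _)
    exact h1.comp (h2.prodMk measurable_id)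
  · refine tendsto_pi_nhds.mpr fun ω => ?_
    set s := capTime (τ ω) t with hs
    refine (ω.rightContinuous' s).tendsto.comp (tendsto_nhdsWithin_iff.mpr ⟨?_, ?_⟩)
    · have hlim : Tendsto (fun k : ℕ => (s : ℝ) + 1 / ((k : ℝ) + 1)) atTop (𝓝 (s : ℝ)) := by
        simpa using tendsto_one_div_add_atTop_nhds_zero_nat.const_add (s : ℝ)
      refine tendsto_subtype_rng.mpr (tendsto_of_tendsto_of_tendsto_of_le_of_le
        tendsto_const_nhds hlim (fun k => ?_) (fun k => ?_))
      · refine le_min (capTime_le _ _) ?_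
        rw [le_div_iff₀ (by positivity)]
        exact (Nat.lt_floor_add_one _).le
      · refine (min_le_right _ _).trans ?_
        rw [div_le_iff₀ (by positivity), add_mul, one_div_mul_cancel (by positivity)]
        exact add_le_add_left (Nat.floor_le (mul_nonneg s.2.1 (by positivity))) _
    · refine Eventually.of_forall fun k => Set.mem_Ici.mpr (Subtype.coe_le_coe.mp ?_)
      refine le_min (capTime_le _ _) ?_
      rw [le_div_iff₀ (by positivity)]
      exact (Nat.lt_floor_add_one _).le

/-- By right-continuity, the size of a move can be read off from a dense set of times. -/
theorem moves_iff_dense {D : Set (Period T)} (hD : Dense D) {δ : ℝ} {ω : PricePath T}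
    {s t : Period T} (hst : s ≤ t) :
    Moves δ ω s t ↔ ∀ k : ℕ, ∃ r ∈ insert t (D ∩ Set.Iic t), s ≤ r ∧
      δ - 1 / ((k : ℝ) + 1) < |ω r - ω s| := by
  constructor
  · intro h k
    obtain ⟨r, hsr, hrt, hr⟩ := h.2 _ (Nat.one_div_pos_of_nat (n := k))
    rcases hrt.eq_or_lt with rfl | hrt
    · exact ⟨r, Set.mem_insert _ _, hsr, hr⟩
    · obtain ⟨d, hd, hclose⟩ := ω.exists_right_close r (sub_pos.mpr hr)
      have hopen : IsOpen (Set.Ioo r t ∩ Metric.ball r d) := isOpen_Ioo.inter Metric.isOpen_ball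
      have hne : (Set.Ioo r t ∩ Metric.ball r d).Nonempty := by
        have : (𝓝[>] r).NeBot := nhdsGT_neBot_of_exists_gt ⟨t, hrt⟩
        exact Filter.nonempty_of_mem (inter_mem (Ioo_mem_nhdsGT hrt)
          (mem_nhdsWithin_of_mem_nhds (Metric.ball_mem_nhds r hd)))
      obtain ⟨q, ⟨hq, hqd⟩, hqD⟩ := hD.inter_open_nonempty _ hopen hne
      refine ⟨q, Set.mem_insert_of_mem _ ⟨hqD, hq.2.le⟩, hsr.trans hq.1.le, ?_⟩
      have h1 := hclose q hq.1.le hqd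
      have h2 := abs_sub_le (ω r) (ω q) (ω s)
      rw [abs_sub_comm (ω r) (ω q)] at h2
      linarith
  · intro h
    refine ⟨hst, fun η hη => ?_⟩
    obtain ⟨k, hk⟩ := exists_nat_one_div_lt hη
    obtain ⟨r, hr, hsr, hlt⟩ := h k
    refine ⟨r, hsr, ?_, by linarith⟩
    rcases hr with rfl | hr
    exacts [le_rfl, hr.2]

/-- Whether a supremum over `[s, t]` reaches `δ` is decided by a countable dense set of times
together with `t`, so no right-continuity of the filtration is needed. -/
theorem isStoppingTime_moveTime (hT : 0 ≤ T) (δ : ℝ) (n : ℕ) :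
    IsStoppingTime (priceFiltration T) (moveTime hT δ n) := by
  induction n with
  | zero => exact isStoppingTime_const _ _
  | succ n ih =>
    intro t
    obtain ⟨D, hDc, hD⟩ := TopologicalSpace.exists_countable_dense (Period T)
    -- The random constraint `s ≤ r` becomes the event `moveTime hT δ n ω ≤ r`, and capping at `t`
    -- makes the starting price measurable at time `t`.
    have hset : {ω | moveTime hT δ (n + 1) ω ≤ t} = {ω | moveTime hT δ n ω ≤ t} ∩
        ⋂ k : ℕ, ⋃ r ∈ insert t (D ∩ Set.Iic t), {ω | moveTime hT δ n ω ≤ r} ∩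
          {ω | δ - 1 / ((k : ℝ) + 1) < |ω r - ω (capTime (moveTime hT δ n ω) t)|} := by
      ext ω
      simp only [Set.mem_ofPred_eq, Set.mem_inter_iff, Set.mem_iInter, Set.mem_iUnion, exists_prop]
      rw [moveTime_succ_le_iff]
      cases h : moveTime hT δ n ω with
      | top => simp
      | coe s =>
        simp only [WithTop.coe_inj, exists_eq_left', WithTop.coe_le_coe, capTime_coe]
        constructor
        · intro hm
          rw [min_eq_left hm.1]
          exact ⟨hm.1, (moves_iff_dense hD hm.1).mp hm⟩
        · rintro ⟨hst, hk⟩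
          rw [min_eq_left hst] at hk
          exact (moves_iff_dense hD hst).mpr hk
    rw [hset]
    refine (ih t).inter (MeasurableSet.iInter fun k => MeasurableSet.biUnion
      ((hDc.mono Set.inter_subset_left).insert t) fun r hr => ?_)
    have hrt : r ≤ t := by
      rcases hr with rfl | hr
      exacts [le_rfl, hr.2]
    refine ((priceFiltration T).mono hrt _ (ih r)).inter ?_
    let _ : MeasurableSpace (PricePath T) := priceFiltration T t
    refine measurableSet_lt measurable_const ?_
    exact continuous_abs.measurable.comp
      (Measurable.sub (measurable_eval hrt) (measurable_eval_capTime ih t))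

/-- A measurable function of the price at a stopping time is known at that stopping time. -/
theorem measurable_comp_eval_capTime (hT : 0 ≤ T) {τ : PricePath T → WithTop (Period T)}
    (hτ : IsStoppingTime (priceFiltration T) τ) {g : ℝ → ℝ} (hg : Measurable g) :
    Measurable[hτ.measurableSpace] fun ω => g (ω (capTime (τ ω) (endTime hT))) := by
  intro B hB
  refine ⟨le_iSup (fun i => (priceFiltration T i : MeasurableSpace (PricePath T))) (endTime hT) _
    ((hg.comp (measurable_eval_capTime hτ (endTime hT))) hB), fun i => ?_⟩
  have : (fun ω => g (ω (capTime (τ ω) (endTime hT)))) ⁻¹' B ∩ {ω | τ ω ≤ i} =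
      (fun ω => g (ω (capTime (τ ω) i))) ⁻¹' B ∩ {ω | τ ω ≤ i} := by
    ext ω
    simp only [Set.mem_inter_iff, Set.mem_preimage, Set.mem_ofPred_eq, and_congr_left_iff]
    intro h
    rw [capTime_of_le h (le_endTime hT i)]
  rw [this]
  exact MeasurableSet.inter ((hg.comp (measurable_eval_capTime hτ i)) hB) (hτ i)

/-! ### The strategy -/

/-- Being long `2 w (L - x)⁺` shares, where `x` is the price at the end of the last move. -/
noncomputable def moveStrategy (hT : 0 ≤ T) {δ L w : ℝ} (hδ : 0 < δ) (hL : 0 ≤ L) (hw : 0 ≤ w) :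
    SimpleStrategy T where
  initial := w * L ^ 2
  time := moveTime hT δ
  isStoppingTime := isStoppingTime_moveTime hT δ
  monotone_time := monotone_moveTime hT δ
  finite_time := finite_moveTime_ne_top hT hδ
  -- The cap at `T` only supplies a value when the time is `⊤`; the next time is then `⊤` too, so
  -- the position earns nothing.
  position n ω := w * (2 * max (L - ω (capTime (moveTime hT δ n ω) (endTime hT))) 0)
  measurable_position n := measurable_comp_eval_capTime hT (isStoppingTime_moveTime hT δ n)
    (g := fun x => w * (2 * max (L - x) 0)) (by fun_prop)
  bounded_position n := by
    refine ⟨w * (2 * L), fun ω => ?_⟩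
    rw [abs_of_nonneg (by positivity)]
    have := ω.nonneg' (capTime (moveTime hT δ n ω) (endTime hT))
    gcongr
    exact max_le (by linarith) hL

section

variable (hT : 0 ≤ T) {δ L w : ℝ} (hδ : 0 < δ) (hL : 0 ≤ L) (hw : 0 ≤ w)

/-- Positions not yet opened at time `t` multiply a zero increment, so the price that determines the
position may be capped at `t` as well. Each term is thereby seen to be known at time `t`. -/
theorem moveStrategy_term (t : Period T) (ω : PricePath T) (n : ℕ) :
    (moveStrategy hT hδ hL hw).position n ω * (ω (capTime (moveTime hT δ (n + 1) ω) t) -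
      ω (capTime (moveTime hT δ n ω) t)) =
    w * (2 * max (L - ω (capTime (moveTime hT δ n ω) t)) 0 *
      (ω (capTime (moveTime hT δ (n + 1) ω) t) - ω (capTime (moveTime hT δ n ω) t))) := by
  rw [← mul_assoc]
  change w * (2 * max (L - ω (capTime (moveTime hT δ n ω) (endTime hT))) 0) * _ = _
  by_cases h : moveTime hT δ n ω ≤ t
  · rw [capTime_of_le h (le_endTime hT t)]
  · have h1 : ∀ τ : WithTop (Period T), ¬ τ ≤ t → capTime τ t = t := by
      intro τ hτ
      cases τ with
      | top => exact capTime_top t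
      | coe s => exact min_eq_right (not_le.mp fun hs => hτ (WithTop.coe_le_coe.mpr hs)).le
    rw [h1 _ h, h1 _ fun h' => h ((monotone_moveTime hT δ ω n.le_succ).trans h')]
    simp

theorem moveStrategy_capital_eq (t : Period T) (ω : PricePath T) {N : ℕ}
    (hN : moveTime hT δ N ω = ⊤) :
    (moveStrategy hT hδ hL hw).capital t ω = w * L ^ 2 +
      ∑ n ∈ Finset.range N, w * (2 * max (L - ω (capTime (moveTime hT δ n ω) t)) 0 *
        (ω (capTime (moveTime hT δ (n + 1) ω) t) - ω (capTime (moveTime hT δ n ω) t))) := by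
  unfold SimpleStrategy.capital
  change w * L ^ 2 + ∑ᶠ n : ℕ, (moveStrategy hT hδ hL hw).position n ω *
    (ω (capTime (moveTime hT δ (n + 1) ω) t) - ω (capTime (moveTime hT δ n ω) t)) = _
  simp only [moveStrategy_term]
  rw [finsum_eq_sum_of_support_subset]
  intro n hn
  simp only [Finset.coe_range, Set.mem_Iio]
  by_contra! hle
  simp [moveTime_eq_top_of_le hle hN, moveTime_eq_top_of_le (hle.trans n.le_succ) hN] at hn

theorem measurable_moveStrategy_capital (t : Period T) :
    Measurable[priceFiltration T t] ((moveStrategy hT hδ hL hw).capital t) := by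
  let _ : MeasurableSpace (PricePath T) := priceFiltration T t
  refine measurable_of_tendsto_metrizable (f := fun N ω => w * L ^ 2 +
      ∑ n ∈ Finset.range N, w * (2 * max (L - ω (capTime (moveTime hT δ n ω) t)) 0 *
        (ω (capTime (moveTime hT δ (n + 1) ω) t) - ω (capTime (moveTime hT δ n ω) t))))
    (fun N => ?_) (tendsto_pi_nhds.mpr fun ω => ?_)
  · have h : ∀ n, Measurable fun ω : PricePath T => ω (capTime (moveTime hT δ n ω) t) :=
      fun n => measurable_eval_capTime (isStoppingTime_moveTime hT δ n) t
    refine measurable_const.add (Finset.measurable_fun_sum _ fun n _ => ?_)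
    exact ((((h n).const_sub L).max measurable_const).const_mul 2 |>.mul
      ((h (n + 1)).sub (h n))).const_mul w
  · obtain ⟨N, hN⟩ := exists_moveTime_eq_top hT hδ ω
    refine tendsto_const_nhds.congr' ?_
    filter_upwards [eventually_ge_atTop N] with m hm
    exact moveStrategy_capital_eq hT hδ hL hw t ω (moveTime_eq_top_of_le hm hN)

theorem moveStrategy_capital_startTime (ω : PricePath T) :
    (moveStrategy hT hδ hL hw).capital (startTime hT) ω = w * L ^ 2 := by
  have h : ∀ τ : WithTop (Period T), capTime τ (startTime hT) = startTime hT := fun τ =>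
    le_antisymm (capTime_le _ _) (startTime_le hT _)
  simp [SimpleStrategy.capital, h, moveStrategy]

/-- The graph of the convex function ((L - x)⁺)² lies above its tangents. -/
theorem sq_max_sub_sq_max_le (L x y : ℝ) :
    max (L - x) 0 ^ 2 - max (L - y) 0 ^ 2 ≤ 2 * max (L - x) 0 * (y - x) := by
  rcases le_total (L - x) 0 with hx | hx
  · rw [max_eq_right hx]
    nlinarith [sq_nonneg (max (L - y) 0)]
  · rw [max_eq_left hx]
    have h := le_max_left (L - y) 0
    nlinarith [sq_nonneg (L - x - max (L - y) 0), mul_nonneg hx (sub_nonneg.mpr h)]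

theorem moveStrategy_capital_nonneg (t : Period T) (ω : PricePath T) :
    0 ≤ (moveStrategy hT hδ hL hw).capital t ω := by
  obtain ⟨N, hN⟩ := exists_moveTime_eq_top hT hδ ω
  rw [moveStrategy_capital_eq hT hδ hL hw t ω hN, ← Finset.mul_sum, ← mul_add]
  refine mul_nonneg hw ?_
  let x (n : ℕ) : ℝ := ω (capTime (moveTime hT δ n ω) t)
  have h1 : ∑ n ∈ Finset.range N, (max (L - x n) 0 ^ 2 - max (L - x (n + 1)) 0 ^ 2) ≤
      ∑ n ∈ Finset.range N, 2 * max (L - x n) 0 * (x (n + 1) - x n) :=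
    Finset.sum_le_sum fun n _ => sq_max_sub_sq_max_le L _ _
  rw [Finset.sum_range_sub'] at h1
  have h2 : max (L - x N) 0 ^ 2 ≤ L ^ 2 := by
    have : 0 ≤ x N := ω.nonneg' _
    gcongr
    exact max_le (by linarith) hL
  have h3 : 0 ≤ max (L - x 0) 0 ^ 2 := sq_nonneg _
  change 0 ≤ L ^ 2 + ∑ n ∈ Finset.range N, 2 * max (L - x n) 0 * (x (n + 1) - x n)
  linarith

/-- On a path bounded by `L` the strategy earns the quadratic variation along the moves. -/
theorem sum_sq_le_moveStrategy_capital {ω : PricePath T} (hωL : ∀ t, ω t ≤ L) {N : ℕ}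
    (hN : moveTime hT δ N ω = ⊤) (t : Period T) :
    w * ∑ n ∈ Finset.range N, (ω (capTime (moveTime hT δ (n + 1) ω) t) -
      ω (capTime (moveTime hT δ n ω) t)) ^ 2 ≤ (moveStrategy hT hδ hL hw).capital t ω := by
  rw [moveStrategy_capital_eq hT hδ hL hw t ω hN, ← Finset.mul_sum, ← mul_add]
  refine mul_le_mul_of_nonneg_left ?_ hw
  let x (n : ℕ) : ℝ := ω (capTime (moveTime hT δ n ω) t)
  have h1 : ∑ n ∈ Finset.range N, 2 * max (L - x n) 0 * (x (n + 1) - x n) =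
      ∑ n ∈ Finset.range N, ((L - x n) ^ 2 - (L - x (n + 1)) ^ 2) +
      ∑ n ∈ Finset.range N, (x (n + 1) - x n) ^ 2 := by
    rw [← Finset.sum_add_distrib]
    refine Finset.sum_congr rfl fun n _ => ?_
    rw [max_eq_left (sub_nonneg.mpr (hωL _))]
    ring
  rw [Finset.sum_range_sub'] at h1
  have h2 : (L - x N) ^ 2 ≤ L ^ 2 := by
    have h0 : 0 ≤ x N := ω.nonneg' _
    have h1 : 0 ≤ L - x N := sub_nonneg.mpr (hωL _)
    gcongr
    linarith
  have h3 : 0 ≤ (L - x 0) ^ 2 := sq_nonneg _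
  change ∑ n ∈ Finset.range N, (x (n + 1) - x n) ^ 2 ≤
    L ^ 2 + ∑ n ∈ Finset.range N, 2 * max (L - x n) 0 * (x (n + 1) - x n)
  linarith

/-- The number of good moves of a bounded path is controlled by the capital earned. -/
theorem exists_finset_isGoodMove {ω : PricePath T} (hωL : ∀ t, ω t ≤ L) :
    ∃ A : Finset (Period T), (∀ r, IsGoodMove hT δ ω r → r ∈ A) ∧
      w * (δ ^ 2 / 4) * A.card ≤ (moveStrategy hT hδ hL hw).capital (endTime hT) ω := by
  classical
  obtain ⟨N, hN⟩ := exists_moveTime_eq_top hT hδ ω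
  let x (n : ℕ) : ℝ := ω (capTime (moveTime hT δ n ω) (endTime hT))
  let I := (Finset.range N).filter fun n => δ / 2 ≤ |x (n + 1) - x n|
  have hx : ∀ {n : ℕ} {s : Period T}, moveTime hT δ n ω = s →
      capTime (moveTime hT δ n ω) (endTime hT) = s := fun {n s} h => by
    rw [h, capTime_coe, min_eq_left (le_endTime hT s)]
  refine ⟨I.image fun n => capTime (moveTime hT δ (n + 1) ω) (endTime hT), ?_, ?_⟩
  · rintro r ⟨n, s, hs, hr, hd⟩
    refine Finset.mem_image.mpr ⟨n, Finset.mem_filter.mpr ⟨Finset.mem_range.mpr ?_, ?_⟩, hx hr⟩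
    · by_contra! hle
      simp [moveTime_eq_top_of_le hle hN] at hs
    · simp only [x]
      rwa [hx hs, hx hr]
  · refine le_trans ?_ (sum_sq_le_moveStrategy_capital hT hδ hL hw hωL hN (endTime hT))
    rw [mul_assoc]
    refine mul_le_mul_of_nonneg_left ?_ hw
    calc δ ^ 2 / 4 * ((I.image _).card : ℝ) ≤ δ ^ 2 / 4 * I.card := by
          gcongr
          exact Finset.card_image_le
      _ = ∑ _n ∈ I, (δ / 2) ^ 2 := by
          rw [Finset.sum_const, nsmul_eq_mul]
          ring
      _ ≤ ∑ n ∈ I, (x (n + 1) - x n) ^ 2 := by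
          refine Finset.sum_le_sum fun n hn => ?_
          rw [← sq_abs (x (n + 1) - x n)]
          have := (Finset.mem_filter.mp hn).2
          gcongr
      _ ≤ _ := Finset.sum_le_sum_of_subset_of_nonneg (Finset.filter_subset _ _)
          fun n _ _ => sq_nonneg _

end

/-! ### Variation and the number of large increments -/

/-- The half-open intervals of a partition are disjoint, so points chosen in different ones are
distinct. -/
theorem card_le_of_forall_exists_mem_Ioc {α : Type*} [LinearOrder α] {n : ℕ}
    {u : Fin (n + 1) → α} (hu : Monotone u) (A : Finset α) (s : Finset (Fin n))
    (h : ∀ i ∈ s, ∃ r ∈ A, u i.castSucc < r ∧ r ≤ u i.succ) : s.card ≤ A.card := by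
  have : Nonempty α := ⟨u 0⟩
  choose! f hfA hf using h
  have hlt : ∀ i ∈ s, ∀ j ∈ s, i < j → f i < f j := fun i hi j hj hij =>
    ((hf i hi).2.trans (hu (Fin.succ_le_castSucc_iff.mpr hij))).trans_lt (hf j hj).1
  refine Finset.card_le_card_of_injOn f hfA fun i hi j hj hij => ?_
  rcases lt_trichotomy i j with hlt' | heq | hlt'
  · exact absurd hij (hlt i hi j hj hlt').ne
  · exact heq
  · exact absurd hij (hlt j hj i hi hlt').ne'

/-- Only the term of the first scale that `d` exceeds is needed. At `m = 0` the bound is `d ≤ D`; at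
a later `m`, failure at the preceding scale gives `d` < 8·4^(-m), whence the constant `D + 8`. -/
theorem ofReal_rpow_le_tsum {d D p : ℝ} (hd : 0 ≤ d) (hdD : d ≤ D) (hp : 0 < p) (J : ℕ) :
    ENNReal.ofReal (d ^ p) ≤ ∑' m : ℕ, if 2 * (1 / 4 : ℝ) ^ (J + m) ≤ d then
      ENNReal.ofReal (((D + 8) * (1 / 4 : ℝ) ^ m) ^ p) else 0 := by
  classical
  rcases hd.eq_or_lt with rfl | hd0
  · simp [Real.zero_rpow hp.ne']
  have hex : ∃ m : ℕ, 2 * (1 / 4 : ℝ) ^ (J + m) ≤ d := by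
    obtain ⟨m, hm⟩ := exists_pow_lt_of_lt_one (half_pos hd0) (by norm_num : (1 / 4 : ℝ) < 1)
    refine ⟨m, ?_⟩
    have : (1 / 4 : ℝ) ^ (J + m) ≤ (1 / 4 : ℝ) ^ m :=
      pow_le_pow_of_le_one (by norm_num) (by norm_num) (Nat.le_add_left _ _)
    linarith
  obtain ⟨m, hm, hmin⟩ : ∃ m : ℕ, 2 * (1 / 4 : ℝ) ^ (J + m) ≤ d ∧
      ∀ k < m, d < 2 * (1 / 4 : ℝ) ^ (J + k) :=
    ⟨Nat.find hex, Nat.find_spec hex, fun k hk => not_le.mp (Nat.find_min hex hk)⟩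
  refine le_trans ?_ (ENNReal.le_tsum m)
  rw [if_pos hm]
  refine ENNReal.ofReal_le_ofReal (Real.rpow_le_rpow hd ?_ hp.le)
  cases m with
  | zero => simpa using hdD.trans (by linarith)
  | succ m =>
    have h1 := hmin m m.lt_succ_self
    have h2 : (1 / 4 : ℝ) ^ (J + m) ≤ (1 / 4 : ℝ) ^ m :=
      pow_le_pow_of_le_one (by norm_num) (by norm_num) (Nat.le_add_left _ _)
    have h3 : 0 ≤ D * (1 / 4 : ℝ) ^ m := mul_nonneg (hd.trans hdD) (by positivity)
    rw [pow_succ]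
    linarith

/-- Up to the polynomial factor, the series is geometric with ratio 16·4^(-p), which is below 1
exactly when p > 2. -/
theorem summable_polynomial_mul_rpow (K E : ℝ) (hE : 0 ≤ E) (J : ℕ) {p : ℝ} (hp : 2 < p) :
    Summable fun m : ℕ => K * ((J + m : ℕ) + 3 : ℝ) ^ 4 * 16 ^ (J + m) *
      (E * (1 / 4 : ℝ) ^ m) ^ p := by
  set q : ℝ := 16 * (1 / 4 : ℝ) ^ p with hq
  have hq0 : 0 < q := by positivity
  have hq1 : q < 1 := by
    have : (1 / 4 : ℝ) ^ p < (1 / 4 : ℝ) ^ (2 : ℝ) :=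
      Real.rpow_lt_rpow_of_exponent_gt (by norm_num) (by norm_num) hp
    have h2 : (1 / 4 : ℝ) ^ (2 : ℝ) = 1 / 16 := by
      rw [Real.rpow_two]
      norm_num
    rw [h2] at this
    linarith
  have hs := summable_pow_mul_geometric_of_norm_lt_one (R := ℝ) 4
    (by rwa [Real.norm_of_nonneg hq0.le] : ‖q‖ < 1)
  have hs' := ((summable_nat_add_iff (J + 3)).mpr hs).mul_left (K * 16 ^ J * E ^ p / q ^ (J + 3))
  refine hs'.congr fun m => ?_
  have h1 : (E * (1 / 4 : ℝ) ^ m) ^ p = E ^ p * ((1 / 4 : ℝ) ^ p) ^ m := by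
    rw [Real.mul_rpow hE (by positivity), ← Real.rpow_natCast, ← Real.rpow_mul (by norm_num),
      mul_comm (m : ℝ), Real.rpow_mul (by norm_num), Real.rpow_natCast]
  have h2 : q ^ m = 16 ^ m * ((1 / 4 : ℝ) ^ p) ^ m := mul_pow _ _ _
  have h3 : q ^ (m + (J + 3)) = q ^ m * q ^ (J + 3) := pow_add _ _ _
  rw [h1, h3, h2, pow_add (16 : ℝ) J m]
  push_cast
  field_simp
  ring

/-- If the number of increments of size `4 ^ (-j)` is of order `16 ^ j`, up to a polynomial, then
the `p`-variation is finite for all `p > 2`. -/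
theorem pVariation_lt_top_of_card_le {f : Period T → ℝ} {D K : ℝ} {J : ℕ}
    (hD : ∀ s t, |f s - f t| ≤ D)
    (hcard : ∀ (n : ℕ) (u : Fin (n + 1) → Period T), Monotone u → ∀ j ≥ J,
      ((Finset.univ.filter fun i : Fin n => 2 * (1 / 4 : ℝ) ^ j ≤
        |f (u i.succ) - f (u i.castSucc)|).card : ℝ) ≤ K * (j + 3 : ℝ) ^ 4 * 16 ^ j)
    {p : ℝ} (hp : 2 < p) : pVariation p f < ∞ := by
  -- Here `T` may be negative, so the period may be empty.
  rcases isEmpty_or_nonempty (Period T) with hemp | ⟨⟨t₀⟩⟩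
  · have : pVariation p f = 0 := by
      simp only [pVariation, ENNReal.iSup_eq_zero]
      exact fun n u => (hemp.false (u 0)).elim
    simp [this]
  have hD0 : 0 ≤ D := (abs_nonneg _).trans (hD t₀ t₀)
  have hsum := summable_polynomial_mul_rpow K (D + 8) (by linarith) J hp
  refine lt_of_le_of_lt ?_ (lt_top_iff_ne_top.mpr hsum.tsum_ofReal_ne_top)
  refine iSup_le fun n => iSup_le fun u => iSup_le fun hu => ?_
  calc ∑ i : Fin n, ENNReal.ofReal (|f (u i.succ) - f (u i.castSucc)| ^ p)
      ≤ ∑ i : Fin n, ∑' m : ℕ, if 2 * (1 / 4 : ℝ) ^ (J + m) ≤ |f (u i.succ) - f (u i.castSucc)|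
          then ENNReal.ofReal (((D + 8) * (1 / 4 : ℝ) ^ m) ^ p) else 0 :=
        Finset.sum_le_sum fun i _ =>
          ofReal_rpow_le_tsum (abs_nonneg _) (hD _ _) (by linarith) J
    _ = ∑' m : ℕ, ∑ i : Fin n, if 2 * (1 / 4 : ℝ) ^ (J + m) ≤ |f (u i.succ) - f (u i.castSucc)|
          then ENNReal.ofReal (((D + 8) * (1 / 4 : ℝ) ^ m) ^ p) else 0 :=
        (Summable.tsum_finsetSum fun i _ => ENNReal.summable).symm
    _ ≤ _ := by
        refine ENNReal.tsum_le_tsum fun m => ?_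
        rw [← Finset.sum_filter, Finset.sum_const, nsmul_eq_mul, ← ENNReal.ofReal_natCast,
          ← ENNReal.ofReal_mul (by positivity)]
        refine ENNReal.ofReal_le_ofReal (mul_le_mul_of_nonneg_right
          (hcard n u hu.2.1 (J + m) (Nat.le_add_right _ _)) (by positivity))

theorem variationIndex_le_two {f : Period T → ℝ} (h : ∀ p : ℝ, 2 < p → pVariation p f < ∞) :
    variationIndex f ≤ 2 := by
  refine ENNReal.le_of_forall_pos_le_add fun ε hε _ => ?_
  have hp : (2 : ℝ) < 2 + ε := lt_add_of_pos_right _ (by exact_mod_cast hε)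
  refine (iInf₂_le (2 + ε : ℝ) ⟨by positivity, h _ hp⟩).trans ?_
  rw [ENNReal.ofReal_add (by norm_num) ε.coe_nonneg]
  simp

/-! ### The combined strategy -/

theorem hasSum_one_div_succ_mul_succ_succ :
    HasSum (fun j : ℕ => 1 / (((j : ℝ) + 1) * (j + 2))) 1 := by
  rw [hasSum_iff_tendsto_nat_of_nonneg fun j => by positivity]
  have h : ∀ n : ℕ, ∑ j ∈ Finset.range n, 1 / (((j : ℝ) + 1) * (j + 2)) = 1 - 1 / ((n : ℝ) + 1) := by
    intro n
    induction n with
    | zero => simp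
    | succ n ih =>
      rw [Finset.sum_range_succ, ih]
      push_cast
      field_simp
      ring
  simp only [h]
  simpa using tendsto_one_div_add_atTop_nhds_zero_nat.const_sub (1 : ℝ)

/-- The strategy following the moves by `4 ^ (-j)` of prices below `j + 1`, with the initial capital
`1 / ((j + 1) (j + 2))`. -/
noncomputable def scaleStrategy (hT : 0 ≤ T) (j : ℕ) : SimpleStrategy T :=
  moveStrategy hT (δ := (1 / 4) ^ j) (L := j + 1) (w := 1 / ((j + 1) * (j + 2)) / (j + 1) ^ 2)
    (by positivity) (by positivity) (by positivity)

theorem scaleStrategy_initial (hT : 0 ≤ T) (j : ℕ) :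
    (scaleStrategy hT j).initial = 1 / (((j : ℝ) + 1) * (j + 2)) :=
  div_mul_cancel₀ _ (by positivity)

theorem scaleStrategy_capital_startTime (hT : 0 ≤ T) (j : ℕ) (ω : PricePath T) :
    (scaleStrategy hT j).capital (startTime hT) ω = 1 / (((j : ℝ) + 1) * (j + 2)) :=
  (moveStrategy_capital_startTime _ _ _ _ _).trans (scaleStrategy_initial hT j)

/-- The sum of the capitals of the strategies for all scales. -/
noncomputable def totalCapital (hT : 0 ≤ T) (t : Period T) (ω : PricePath T) : ℝ≥0∞ :=
  ∑' j, ENNReal.ofReal ((scaleStrategy hT j).capital t ω)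

theorem isPositiveCapitalProcess_totalCapital (hT : 0 ≤ T) :
    IsPositiveCapitalProcess (totalCapital hT) := by
  refine ⟨fun t => ?_, scaleStrategy hT, fun j t ω => moveStrategy_capital_nonneg _ _ _ _ t ω, ?_,
    fun _ _ => rfl⟩
  · let _ : MeasurableSpace (PricePath T) := priceFiltration T t
    exact Measurable.tsum fun j =>
      (measurable_moveStrategy_capital hT _ _ _ t).ennreal_ofReal
  · simp only [scaleStrategy_initial]
    exact hasSum_one_div_succ_mul_succ_succ.summable

theorem totalCapital_startTime (hT : 0 ≤ T) (ω : PricePath T) :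
    totalCapital hT (startTime hT) ω = 1 := by
  simp only [totalCapital, scaleStrategy_capital_startTime]
  rw [← ENNReal.ofReal_tsum_of_nonneg (fun j => by positivity)
    hasSum_one_div_succ_mul_succ_succ.summable, hasSum_one_div_succ_mul_succ_succ.tsum_eq,
    ENNReal.ofReal_one]

/-- The capital at scale `j` is one nonnegative summand of the total. Dividing by its weight and by
the gain `δ ^ 2 / 4` per good move costs the factor 4(j + 1)³(j + 2)16^j. -/
theorem exists_finset_isGoodMove_of_totalCapital_ne_top (hT : 0 ≤ T) {ω : PricePath T}
    (h : totalCapital hT (endTime hT) ω ≠ ∞) {j : ℕ} (hj : ∀ t, ω t ≤ j) :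
    ∃ A : Finset (Period T), (∀ r, IsGoodMove hT ((1 / 4) ^ j) ω r → r ∈ A) ∧
      (A.card : ℝ) ≤ 4 * (totalCapital hT (endTime hT) ω).toReal * (j + 2 : ℝ) ^ 4 * 16 ^ j := by
  obtain ⟨A, hA, hcard⟩ := exists_finset_isGoodMove hT (δ := (1 / 4) ^ j) (L := j + 1)
    (w := 1 / ((j + 1) * (j + 2)) / (j + 1) ^ 2) (by positivity) (by positivity) (by positivity)
    (ω := ω) fun t => (hj t).trans (by linarith)
  refine ⟨A, hA, ?_⟩
  set C := (totalCapital hT (endTime hT) ω).toReal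
  have hC : (scaleStrategy hT j).capital (endTime hT) ω ≤ C :=
    (ENNReal.ofReal_le_iff_le_toReal h).mp (ENNReal.le_tsum j)
  have hC0 : 0 ≤ C := ENNReal.toReal_nonneg
  have h1 := hcard.trans hC
  have h2 : (1 / (((j : ℝ) + 1) * (j + 2)) / (j + 1) ^ 2) * (((1 / 4 : ℝ) ^ j) ^ 2 / 4) * A.card =
      A.card / (4 * ((j + 1 : ℝ) ^ 3 * (j + 2)) * 16 ^ j) := by
    have h16 : ((1 / 4 : ℝ) ^ j) ^ 2 = 1 / 16 ^ j := by
      rw [← pow_mul, mul_comm j, pow_mul, ← one_div_pow]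
      norm_num
    rw [h16]
    field_simp
  rw [h2, div_le_iff₀ (by positivity)] at h1
  have h3 : (j + 1 : ℝ) ^ 3 * (j + 2) ≤ (j + 2 : ℝ) ^ 4 := by
    rw [pow_succ (j + 2 : ℝ) 3]
    gcongr
    norm_num
  calc (A.card : ℝ) ≤ C * (4 * ((j + 1 : ℝ) ^ 3 * (j + 2)) * 16 ^ j) := h1
    _ ≤ C * (4 * (j + 2 : ℝ) ^ 4 * 16 ^ j) := by gcongr
    _ = _ := by ring

theorem variationIndex_le_two_of_totalCapital_ne_top (hT : 0 ≤ T) {ω : PricePath T}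
    (h : totalCapital hT (endTime hT) ω ≠ ∞) : variationIndex (fun t => ω t) ≤ 2 := by
  classical
  obtain ⟨D, hD⟩ := ω.exists_bound
  obtain ⟨J, hJ⟩ := exists_nat_ge D
  set C := (totalCapital hT (endTime hT) ω).toReal
  have hC0 : 0 ≤ C := ENNReal.toReal_nonneg
  -- The constant 68 = 4 + 4·16 adds the counts at scales `j` and `j + 1`; starting from `J` ensures
  -- that the path lies below the levels of both strategies.
  refine variationIndex_le_two fun p hp =>
    pVariation_lt_top_of_card_le (D := D) (K := 68 * C) (J := J) (fun s t => ?_)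
      (fun n u hu j hj => ?_) hp
  · exact abs_sub_le_of_nonneg_of_le (ω.nonneg' s) (hD s) (ω.nonneg' t) (hD t)
  · have hωj : ∀ t, ω t ≤ j := fun t => (hD t).trans (hJ.trans (Nat.cast_le.mpr hj))
    obtain ⟨A, hA, hAcard⟩ := exists_finset_isGoodMove_of_totalCapital_ne_top hT h hωj
    obtain ⟨B, hB, hBcard⟩ := exists_finset_isGoodMove_of_totalCapital_ne_top hT h (j := j + 1)
      fun t => (hωj t).trans (Nat.cast_le.mpr j.le_succ)
    have hle := card_le_of_forall_exists_mem_Ioc hu (A ∪ B) (Finset.univ.filter fun i : Fin n =>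
        2 * (1 / 4 : ℝ) ^ j ≤ |ω (u i.succ) - ω (u i.castSucc)|) fun i hi => by
      obtain ⟨r, h1, h2, hr⟩ := exists_isGoodMove_mem_Ioc hT (by positivity)
        (hu (Fin.castSucc_le_succ i)) (Finset.mem_filter.mp hi).2
      refine ⟨r, Finset.mem_union.mpr (hr.imp (hA r) fun hr => hB r ?_), h1, h2⟩
      rwa [pow_succ, mul_one_div]
    have hle' : ((Finset.univ.filter fun i : Fin n => 2 * (1 / 4 : ℝ) ^ j ≤
        |ω (u i.succ) - ω (u i.castSucc)|).card : ℝ) ≤ A.card + B.card := by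
      exact_mod_cast hle.trans (Finset.card_union_le A B)
    have h1 : 4 * C * (j + 2 : ℝ) ^ 4 * 16 ^ j ≤ 4 * C * (j + 3 : ℝ) ^ 4 * 16 ^ j := by
      gcongr
      norm_num
    have h2 : 4 * C * ((j + 1 : ℕ) + 2 : ℝ) ^ 4 * 16 ^ (j + 1) =
        64 * C * (j + 3 : ℝ) ^ 4 * 16 ^ j := by
      push_cast
      ring
    linarith

end TypicalPaths

/-- For typical positive càdlàg price paths on `[0, T]`, the variation index is at most `2`. -/
theorem theorem1 (T : ℝ) (hT : 0 ≤ T) :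
    TypicalPaths.ForTypical hT
      (fun ω : TypicalPaths.PricePath T => TypicalPaths.variationIndex (fun t => ω t) ≤ 2) := by
  refine ⟨TypicalPaths.totalCapital hT, TypicalPaths.isPositiveCapitalProcess_totalCapital hT,
    TypicalPaths.totalCapital_startTime hT, fun ω hω => ?_⟩
  by_contra h
  exact hω (TypicalPaths.variationIndex_le_two_of_totalCapital_ne_top hT h)
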